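/- Let $S$ and $E$ be quantum systems of finite dimensions $d_S, d_E \ge 2$, and let $|\Phi\rangle_{SE} \in \mathbb{C}^{d_S}\otimes\mathbb{C}^{d_E}$ be a unit vector that is not maximally entangled (maximally entangled means: the reduced state of the smaller of the two systems is maximally mixed, equivalently all $\min(d_S,d_E)$ Schmidt coefficients are equal). A unitary $U$ on $\mathbb{C}^{d_S}\otimes\mathbb{C}^{d_E}$ is called entangling if it maps some product state to a non-product state. We say that $U$ induces CP dynamics on $S$, acting on $|\Phi\rangle$, if there are a Hamiltonian $H$, times $t>0$ and $s\ge 0$, and a pre-initial product state $|\psi\rangle_S\otimes|\phi\rangle_E$ such that $U=e^{-iHt}$ and $|\Phi\rangle = e^{-iHs}\,|\psi\rangle\otimes|\phi\rangle$, and such that the reduced dynamics $$\Lambda_r(\rho)=\mathrm{Tr}_E\left[e^{-iHr}\left(\rho\otimes|\phi\rangle\langle\phi|\right)e^{iHr}\right]$$ has the following property: $\Lambda_s$ is invertible, and for every $\tau\in[0,t]$ the intermediate map $\Lambda_{s+\tau}\circ\Lambda_s^{-1}$ is completely positive and trace preserving. Let $\mathcal{U}(\Phi)\subset SU(d_Sd_E)$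 be the set of all entangling unitaries in $SU(d_Sd_E)$ that induce CP dynamics on $S$, acting on $|\Phi\rangle$. Write $|G|$ for the dimension (number of real parameters) of a Lie group $G$. Then: 1. $\mathcal{U}(\Phi)$ is infinite. 2. If the environment is large enough, namely $d_E\ge 4$, then the dimension $D$ of $\mathcal{U}(\Phi)$ relative to $SU(d_Sd_E)$, that is, its Hausdorff dimension (for the Hilbert-Schmidt distance) divided by $|SU(d_Sd_E)|$, satisfies the parameter-count lower bound $$D \;\ge\; R(d_S,d_E) := \frac{|SU(d_S)\times SU(d_E)|}{|SU(d_Sd_E)|}.$$ 3. $R(d_S,d_E)$ scales like $\dfrac{d_S^2+d_E^2}{d_S^2d_E^2}$: the quotient of the two quantities tends to $1$ as $d_S+d_E\to\infty$ with $d_S,d_E\ge 2$. Moreover, for every fixed $d_S\ge 2$, $R(d_S,d_E)\to d_S^{-2}$ as $d_E\to\infty$. -/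

import Mathlib

open scoped Kronecker ENNReal ComplexOrder

/-- A unit vector (pure state), for the standard Hermitian inner product on `ι → ℂ`. -/
def IsState {ι : Type} [Fintype ι] (v : ι → ℂ) : Prop :=
  star v ⬝ᵥ v = 1

/-- The product vector `ψ ⊗ φ` of a system vector and an environment vector. -/
def prodVec {dS dE : ℕ} (ψ : Fin dS → ℂ) (φ : Fin dE → ℂ) : Fin dS × Fin dE → ℂ :=
  fun p => ψ p.1 * φ p.2

/-- The rank-one matrix `|v⟩⟨v|`. -/
def ketBra {ι : Type} (v : ι → ℂ) : Matrix ι ι ℂ :=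
  Matrix.vecMulVec v (star v)

/-- Partial trace over the environment. -/
def traceE {dS dE : ℕ} (X : Matrix (Fin dS × Fin dE) (Fin dS × Fin dE) ℂ) :
    Matrix (Fin dS) (Fin dS) ℂ :=
  Matrix.of fun i j => ∑ k, X (i, k) (j, k)

/-- Partial trace over the system. -/
def traceS {dS dE : ℕ} (X : Matrix (Fin dS × Fin dE) (Fin dS × Fin dE) ℂ) :
    Matrix (Fin dE) (Fin dE) ℂ :=
  Matrix.of fun k l => ∑ i, X (i, k) (i, l)

/-- A bipartite pure state is maximally entangled if the reduced state of the smaller of the two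
parties (of both, when the dimensions agree) is maximally mixed; equivalently, all its
`min dS dE` Schmidt coefficients are equal. -/
def IsMaxEntangled {dS dE : ℕ} (Φ : Fin dS × Fin dE → ℂ) : Prop :=
  (dS ≤ dE → traceE (ketBra Φ) = (dS : ℂ)⁻¹ • (1 : Matrix (Fin dS) (Fin dS) ℂ)) ∧
  (dE ≤ dS → traceS (ketBra Φ) = (dE : ℂ)⁻¹ • (1 : Matrix (Fin dE) (Fin dE) ℂ))

/-- A joint unitary is entangling if it maps some product state to a state that is not a
product state. -/
def IsEntangling {dS dE : ℕ} (U : Matrix (Fin dS × Fin dE) (Fin dS × Fin dE) ℂ) : Prop :=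
  ∃ (ψ : Fin dS → ℂ) (φ : Fin dE → ℂ), IsState ψ ∧ IsState φ ∧
    ¬ ∃ (ψ' : Fin dS → ℂ) (φ' : Fin dE → ℂ), U.mulVec (prodVec ψ φ) = prodVec ψ' φ'

/-- The evolution operator `e^{-iHt}`. -/
noncomputable def evolution {ι : Type} [Fintype ι] [DecidableEq ι] (H : Matrix ι ι ℂ) (t : ℝ) :
    Matrix ι ι ℂ :=
  NormedSpace.exp ((-(Complex.I * (t : ℂ))) • H)

/-- The reduced dynamical map of the system after time `τ`, when the joint system evolves under
`H` and the environment starts in the state `φ`: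
`ρ ↦ Tr_E [e^{-iHτ} (ρ ⊗ |φ⟩⟨φ|) e^{iHτ}]`. -/
noncomputable def dynMap {dS dE : ℕ} (H : Matrix (Fin dS × Fin dE) (Fin dS × Fin dE) ℂ)
    (φ : Fin dE → ℂ) (τ : ℝ) :
    Matrix (Fin dS) (Fin dS) ℂ →ₗ[ℂ] Matrix (Fin dS) (Fin dS) ℂ where
  toFun ρ := traceE (evolution H τ * (ρ ⊗ₖ ketBra φ) * (evolution H τ).conjTranspose)
  map_add' ρ σ := by
    ext i j
    simp [traceE, Matrix.add_kronecker, Matrix.mul_add, Matrix.add_mul, Finset.sum_add_distrib]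
  map_smul' c ρ := by
    ext i j
    simp [traceE, Matrix.smul_kronecker, Finset.mul_sum]

/-- The amplification `Λ ⊗ id_n` of a linear map `Λ` on `d × d` matrices. -/
def amplify {d : ℕ} (Λ : Matrix (Fin d) (Fin d) ℂ →ₗ[ℂ] Matrix (Fin d) (Fin d) ℂ) (n : ℕ)
    (X : Matrix (Fin d × Fin n) (Fin d × Fin n) ℂ) : Matrix (Fin d × Fin n) (Fin d × Fin n) ℂ :=
  Matrix.of fun p q => Λ (Matrix.of fun i j => X (i, p.2) (j, q.2)) p.1 q.1

/-- Complete positivity: all amplifications preserve positive semidefiniteness. -/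
def IsCP {d : ℕ} (Λ : Matrix (Fin d) (Fin d) ℂ →ₗ[ℂ] Matrix (Fin d) (Fin d) ℂ) : Prop :=
  ∀ (n : ℕ) (X : Matrix (Fin d × Fin n) (Fin d × Fin n) ℂ),
    X.PosSemidef → (amplify Λ n X).PosSemidef

/-- Trace preservation. -/
def IsTP {d : ℕ} (Λ : Matrix (Fin d) (Fin d) ℂ →ₗ[ℂ] Matrix (Fin d) (Fin d) ℂ) : Prop :=
  ∀ X : Matrix (Fin d) (Fin d) ℂ, (Λ X).trace = X.trace

/-- The unitary `U`, acting on the joint state `Φ` given at time `0`, induces completely positive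
dynamics on the system: `U = e^{-iHt}` for a Hamiltonian `H` and a time `t > 0`; the evolution
generated by `H` reaches `Φ` from a pre-initial product state `ψ ⊗ φ` at the time `-s ≤ 0`; and
the evolution of the system during the interval `[0, t]`, that is, for every `0 ≤ τ ≤ t`, the
intermediate map `dynMap H φ (s + τ) ∘ (dynMap H φ s)⁻¹` from time `0` to time `τ`, exists and is
completely positive and trace preserving. -/
def InducesCP {dS dE : ℕ} (Φ : Fin dS × Fin dE → ℂ)
    (U : Matrix (Fin dS × Fin dE) (Fin dS × Fin dE) ℂ) : Prop :=
  ∃ (H : Matrix (Fin dS × Fin dE) (Fin dS × Fin dE) ℂ) (t s : ℝ)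
    (ψ : Fin dS → ℂ) (φ : Fin dE → ℂ),
    H.IsHermitian ∧ 0 < t ∧ U = evolution H t ∧
    0 ≤ s ∧ IsState ψ ∧ IsState φ ∧ Φ = (evolution H s).mulVec (prodVec ψ φ) ∧
    Function.Bijective (dynMap H φ s) ∧
    ∀ τ : ℝ, 0 ≤ τ → τ ≤ t →
      ∃ Λ : Matrix (Fin dS) (Fin dS) ℂ →ₗ[ℂ] Matrix (Fin dS) (Fin dS) ℂ,
        IsCP Λ ∧ IsTP Λ ∧ Λ ∘ₗ dynMap H φ s = dynMap H φ (s + τ)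

/-- The set of entangling unitaries in `SU(dS dE)` that induce completely positive dynamics on the
system when they act on `Φ`. -/
def cpUnitaries {dS dE : ℕ} (Φ : Fin dS × Fin dE → ℂ) :
    Set (Matrix (Fin dS × Fin dE) (Fin dS × Fin dE) ℂ) :=
  {U | U ∈ Matrix.specialUnitaryGroup (Fin dS × Fin dE) ℂ ∧ IsEntangling U ∧ InducesCP Φ U}

/-- The Lie algebra `su(n)`, as a real vector space: traceless skew-Hermitian matrices. -/
def suLie (n : ℕ) : Submodule ℝ (Matrix (Fin n) (Fin n) ℂ) where
  carrier := {X | X.conjTranspose = -X ∧ X.trace = 0}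
  zero_mem' := by simp
  add_mem' := by
    rintro X Y ⟨hX, hX'⟩ ⟨hY, hY'⟩
    refine ⟨?_, ?_⟩
    · rw [Matrix.conjTranspose_add, hX, hY]; abel
    · rw [Matrix.trace_add, hX', hY', add_zero]
  smul_mem' := by
    rintro c X ⟨hX, hX'⟩
    refine ⟨?_, ?_⟩
    · rw [Matrix.conjTranspose_smul, hX]; simp
    · rw [Matrix.trace_smul, hX', smul_zero]

/-- The dimension of the Lie group `SU(n)`: the number of real parameters of an `n × n` special
unitary matrix. -/
noncomputable def dimSU (n : ℕ) : ℕ :=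
  Module.finrank ℝ (suLie n)

/-- The ratio of the number of parameters of a pair of local unitaries, an element of
`SU(dS) × SU(dE)`, to the number of parameters of a joint unitary in `SU(dS dE)`. -/
noncomputable def paramRatio (dS dE : ℕ) : ℝ :=
  ((dimSU dS : ℝ) + (dimSU dE : ℝ)) / (dimSU (dS * dE) : ℝ)

/-- The Hausdorff dimension of a set of complex matrices, for the Hilbert-Schmidt distance. -/
noncomputable def matrixDimH {ι : Type} [Fintype ι] (A : Set (Matrix ι ι ℂ)) : ℝ≥0∞ :=
  dimH {x : EuclideanSpace ℂ (ι × ι) | (Matrix.of fun i j => x (i, j)) ∈ A}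

/-- The dimension of a set of joint unitaries relative to that of `SU(dS dE)`. -/
noncomputable def relDim {dS dE : ℕ}
    (A : Set (Matrix (Fin dS × Fin dE) (Fin dS × Fin dE) ℂ)) : ℝ≥0∞ :=
  matrixDimH A / (dimSU (dS * dE) : ℝ≥0∞)

/-!
Every pure state `Φ`, maximally entangled or not, can be produced by generalised amplitude damping,
and amplitude damping is CP-divisible.

Let `a ⊗ φ` be a pair of Schmidt vectors of `Φ` with coefficient `cos s > 0`, so that
`Φ = cos s • (a ⊗ φ) + sin s • ω` with a unit vector `ω ∈ a^⊥ ⊗ φ^⊥`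
(`exists_isDampingFrame`). The Hamiltonian that rotates `a ⊗ φ` into `ω` at unit speed and kills
`x ⊗ φ` for `x ⊥ a` reaches `Φ` from `a ⊗ φ` at time `s`. With the environment started in `φ`, its
reduced dynamics at time `r` is the map `ampDamp a σ (cos r)`: the population of `a` is multiplied
by `cos² r`, its coherences by `cos r`, and the lost population reappears as the fixed state
`σ = Tr_E |ω⟩⟨ω|` on `a^⊥` (`IsDampingFrame.dynMap_eq_ampDamp`). These maps multiply their
parameters under composition (`ampDamp_comp`), so the intermediate map from `s` to `s + τ` is
`ampDamp a σ (cos (s + τ) / cos s)`, which is completely positive and trace preserving as long as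
`s + τ < π / 2`. Varying `t` alone gives infinitely many unitaries (`cpUnitaries_infinite`).

None of this changes if an arbitrary `Y ∈ su(n)` is added to the generator on `n` dimensions of
the orthogonal complement of `ℂ^dS ⊗ φ + ℂ ω`, where `n = dS * dE - (dS + 1)`. Compressing the
resulting unitaries to these `n` dimensions is a linear, hence Lipschitz, map, and it gives all
`exp (t Y)`; a linear projection onto `su(n)` maps these onto a neighbourhood, since `exp` has an
invertible derivative at `0`. So the Hausdorff dimension is at least `dim SU(n)`
(`dimSU_le_matrixDimH_cpUnitaries`), and for `dE ≥ 4` this is at least `dim SU(dS) + dim SU(dE)`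
(`dimSU_add_dimSU_le`). The asymptotics of the ratio follow from `dim SU(n) = n² - 1`.
-/

/-! ### Exponentials of matrices -/

theorem exp_mul_eq_mul_exp {m k : Type} [Fintype m] [DecidableEq m] [Fintype k] [DecidableEq k]
    {A : Matrix m m ℂ} {J : Matrix m k ℂ} {B : Matrix k k ℂ} (h : A * J = J * B) :
    NormedSpace.exp A * J = J * NormedSpace.exp B := by
  let := Matrix.linftyOpNormedRing (n := m) (α := ℂ)
  let := Matrix.linftyOpNormedAlgebra (n := m) (R := ℂ) (α := ℂ)
  let := Matrix.linftyOpNormedRing (n := k) (α := ℂ)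
  let := Matrix.linftyOpNormedAlgebra (n := k) (R := ℂ) (α := ℂ)
  have hpow : ∀ n : ℕ, A ^ n * J = J * B ^ n := by
    intro n
    induction n with
    | zero => simp
    | succ n ih => rw [pow_succ, Matrix.mul_assoc, h, ← Matrix.mul_assoc, ih, Matrix.mul_assoc,
        ← pow_succ]
  have hA := (NormedSpace.exp_series_hasSum_exp' (𝕂 := ℂ) A).map
    (AddMonoidHom.mk' (fun X : Matrix m m ℂ => X * J) fun X Y => Matrix.add_mul X Y J)
    (continuous_id.matrix_mul continuous_const)
  have hB := (NormedSpace.exp_series_hasSum_exp' (𝕂 := ℂ) B).map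
    (AddMonoidHom.mk' (fun X : Matrix k k ℂ => J * X) fun X Y => Matrix.mul_add J X Y)
    (continuous_const.matrix_mul continuous_id)
  refine hA.unique ?_
  convert hB using 1
  · funext n
    simp [hpow]
  · rfl

theorem exp_mulVec_of_eigenvector {m : Type} [Fintype m] [DecidableEq m]
    {A : Matrix m m ℂ} {v : m → ℂ} {c : ℂ} (h : A.mulVec v = c • v) :
    (NormedSpace.exp A).mulVec v = Complex.exp c • v := by
  let J : Matrix m Unit ℂ := Matrix.of fun i _ => v i
  let B : Matrix Unit Unit ℂ := Matrix.diagonal fun _ => c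
  have h1 : A * J = J * B := by
    ext i j
    rw [Matrix.mul_diagonal, mul_comm]
    exact congrFun h i
  have h2 := exp_mul_eq_mul_exp h1
  rw [Matrix.exp_diagonal] at h2
  ext i
  have h3 := congrFun (congrFun h2 i) ()
  rw [Matrix.mul_diagonal, Pi.coe_exp, ← Complex.exp_eq_exp_ℂ, mul_comm] at h3
  exact h3

/-- The exponential maps `su(m)` into `SU(m)`. The determinant is computed in an eigenbasis of the
Hermitian matrix `i A`. -/
theorem exp_mem_specialUnitaryGroup {m : Type} [Fintype m] [DecidableEq m]
    {A : Matrix m m ℂ} (hA : A.conjTranspose = -A) (htr : A.trace = 0) :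
    NormedSpace.exp A ∈ Matrix.specialUnitaryGroup m ℂ := by
  rw [Matrix.mem_specialUnitaryGroup_iff]
  constructor
  · rw [Matrix.mem_unitaryGroup_iff', Matrix.star_eq_conjTranspose, ← Matrix.exp_conjTranspose, hA,
      Matrix.exp_neg]
    exact Matrix.nonsing_inv_mul _ ((Matrix.isUnit_iff_isUnit_det _).1 (Matrix.isUnit_exp A))
  · have hH : (Complex.I • A).IsHermitian := by
      simp [Matrix.IsHermitian, Matrix.conjTranspose_smul, hA]
    set U : Matrix m m ℂ := (hH.eigenvectorUnitary : Matrix m m ℂ) with hU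
    have hUU : star U * U = 1 := Unitary.star_mul_self_of_mem hH.eigenvectorUnitary.2
    set D : m → ℂ := fun i => -Complex.I * (hH.eigenvalues i : ℂ) with hD
    have hAU : A * U = U * Matrix.diagonal D := by
      have h1 : (Complex.I • A) * U
          = U * Matrix.diagonal (fun i => (hH.eigenvalues i : ℂ)) := by
        conv_lhs => rw [hH.spectral_theorem, Unitary.conjStarAlgAut_apply]
        rw [← hU, Matrix.mul_assoc, hUU, Matrix.mul_one]
        rfl
      have h2 : Matrix.diagonal D
          = (-Complex.I) • Matrix.diagonal (fun i => (hH.eigenvalues i : ℂ)) := by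
        rw [← Matrix.diagonal_smul]
        rfl
      rw [h2, Matrix.mul_smul, ← h1, Matrix.smul_mul, smul_smul]
      simp
    have hsum : ∑ i, D i = 0 := by
      have h3 := hH.trace_eq_sum_eigenvalues
      rw [Matrix.trace_smul, htr, smul_zero] at h3
      rw [hD, ← Finset.mul_sum]
      exact mul_eq_zero_of_right _ h3.symm
    have hdet := congrArg Matrix.det (exp_mul_eq_mul_exp hAU)
    rw [Matrix.exp_diagonal, Matrix.det_mul, Matrix.det_mul, Matrix.det_diagonal, mul_comm] at hdet
    have hU0 : U.det ≠ 0 := by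
      intro h0
      have := congrArg Matrix.det hUU
      rw [Matrix.det_mul, h0, mul_zero, Matrix.det_one] at this
      exact zero_ne_one this
    rw [mul_left_cancel₀ hU0 hdet]
    simp only [Pi.coe_exp, ← Complex.exp_eq_exp_ℂ]
    rw [← Complex.exp_sum, hsum, Complex.exp_zero]

/-! ### The dimension of `SU(n)` and the parameter ratio -/

/-- `A ↦ (A - Aᵀ) + i (A + Aᵀ)` identifies the real traceless matrices with `su(n)`, up to a
factor `2`. -/
theorem dimSU_eq {n : ℕ} (hn : 1 ≤ n) : dimSU n = n ^ 2 - 1 := by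
  let e : suLie n ≃ₗ[ℝ] LinearMap.ker (Matrix.traceLinearMap (Fin n) ℝ ℝ) :=
    { toFun := fun X => ⟨Matrix.of fun i j => (X.1 i j).re + (X.1 i j).im, by
        obtain ⟨h1, h2⟩ := X.2
        have hre : ∀ i, (X.1 i i).re = 0 := by
          intro i
          have := congrArg Complex.re (congrFun (congrFun h1 i) i)
          simp at this
          linarith
        have him := congrArg Complex.im h2
        simp only [Matrix.trace, Matrix.diag_apply, Complex.im_sum, Complex.zero_im] at him
        simp [Matrix.trace, hre, him]⟩
      invFun := fun A => ⟨Matrix.of fun i j =>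
          (⟨(A.1 i j - A.1 j i) / 2, (A.1 i j + A.1 j i) / 2⟩ : ℂ), by
        have h := A.2
        simp only [LinearMap.mem_ker, Matrix.traceLinearMap_apply, Matrix.trace,
          Matrix.diag_apply] at h
        constructor
        · ext i j
          apply Complex.ext <;> simp <;> ring
        · apply Complex.ext <;> simp [Matrix.trace, Complex.re_sum, Complex.im_sum, h]⟩
      map_add' := by
        intro X Y
        ext i j
        simp
        ring
      map_smul' := by
        intro c X
        ext i j
        simp
        ring
      left_inv := by
        intro X
        obtain ⟨h1, h2⟩ := X.2
        ext i j
        have hre := congrArg Complex.re (congrFun (congrFun h1 i) j)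
        have him := congrArg Complex.im (congrFun (congrFun h1 i) j)
        simp at hre him
        apply Complex.ext <;> simp <;> linarith
      right_inv := by
        intro A
        ext i j
        simp
        ring }
  have hsurj : LinearMap.range (Matrix.traceLinearMap (Fin n) ℝ ℝ) = ⊤ := by
    have : Nonempty (Fin n) := ⟨⟨0, hn⟩⟩
    exact LinearMap.range_eq_top.2 (Matrix.trace_surjective)
  have h := LinearMap.finrank_range_add_finrank_ker (Matrix.traceLinearMap (Fin n) ℝ ℝ)
  rw [hsurj, finrank_top, Module.finrank_self, Module.finrank_matrix, Module.finrank_self,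
    Fintype.card_fin] at h
  rw [dimSU, e.finrank_eq, sq]
  omega

theorem paramRatio_eq {dS dE : ℕ} (hS : 1 ≤ dS) (hE : 1 ≤ dE) :
    paramRatio dS dE
      = ((dS : ℝ) ^ 2 + (dE : ℝ) ^ 2 - 2) / ((dS : ℝ) ^ 2 * (dE : ℝ) ^ 2 - 1) := by
  have h1 : ∀ n : ℕ, 1 ≤ n → (dimSU n : ℝ) = (n : ℝ) ^ 2 - 1 := by
    intro n hn
    rw [dimSU_eq hn, Nat.cast_sub (Nat.one_le_pow _ _ hn)]
    push_cast
    ring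
  rw [paramRatio, h1 dS hS, h1 dE hE, h1 _ (Nat.mul_pos hS hE)]
  push_cast
  ring

theorem abs_paramRatio_div_sub_one_le {dS dE : ℕ} (hS : 2 ≤ dS) (hE : 2 ≤ dE) :
    |paramRatio dS dE / (((dS : ℝ) ^ 2 + (dE : ℝ) ^ 2) / ((dS : ℝ) ^ 2 * (dE : ℝ) ^ 2)) - 1|
      ≤ 4 / ((dS : ℝ) + dE) := by
  have hS' : (2 : ℝ) ≤ dS := by exact_mod_cast hS
  have hE' : (2 : ℝ) ≤ dE := by exact_mod_cast hE
  have hSx : (2 : ℝ) * dS ≤ (dS : ℝ) ^ 2 := by nlinarith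
  have hEy : (2 : ℝ) * dE ≤ (dE : ℝ) ^ 2 := by nlinarith
  rw [paramRatio_eq (by omega) (by omega)]
  generalize hx : (dS : ℝ) ^ 2 = x at *
  generalize hy : (dE : ℝ) ^ 2 = y at *
  have hx4 : 4 ≤ x := by linarith
  have hy4 : 4 ≤ y := by linarith
  have hxy : 16 ≤ x * y := by nlinarith
  have hxy' : x + y ≤ 2 * (x * y) := by nlinarith
  have key : (x + y - 2) / (x * y - 1) / ((x + y) / (x * y)) - 1
      = -((2 * (x * y) - (x + y)) / ((x * y - 1) * (x + y))) := by
    have h1 : x * y - 1 ≠ 0 := by linarith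
    have h2 : x + y ≠ 0 := by linarith
    have h3 : x ≠ 0 := by linarith
    have h4 : y ≠ 0 := by linarith
    field_simp
    ring
  have hpos : 0 < (x * y - 1) * (x + y) := mul_pos (by linarith) (by linarith)
  rw [key, abs_neg, abs_of_nonneg (div_nonneg (by linarith) hpos.le),
    div_le_div_iff₀ hpos (by linarith)]
  have h5 : 2 * (x * y) - (x + y) ≤ 4 * (x * y - 1) := by linarith
  calc (2 * (x * y) - (x + y)) * (dS + dE)
      ≤ (4 * (x * y - 1)) * (x + y) := by
        apply mul_le_mul h5 (by linarith) (by linarith) (by linarith)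
    _ = 4 * ((x * y - 1) * (x + y)) := by ring

theorem tendsto_paramRatio {dS : ℕ} (hS : 2 ≤ dS) :
    Filter.Tendsto (fun dE : ℕ => paramRatio dS dE) Filter.atTop (nhds (((dS : ℝ) ^ 2)⁻¹)) := by
  have hx : (dS : ℝ) ^ 2 ≠ 0 := by positivity
  have hinv : Filter.Tendsto (fun n : ℕ => ((n : ℝ) ^ 2)⁻¹) Filter.atTop (nhds 0) :=
    ((Filter.tendsto_pow_atTop two_ne_zero).comp tendsto_natCast_atTop_atTop).inv_tendsto_atTop
  have hlim : Filter.Tendsto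
      (fun n : ℕ => (((dS : ℝ) ^ 2 - 2) * ((n : ℝ) ^ 2)⁻¹ + 1) / ((dS : ℝ) ^ 2 - ((n : ℝ) ^ 2)⁻¹))
      Filter.atTop (nhds ((((dS : ℝ) ^ 2 - 2) * 0 + 1) / ((dS : ℝ) ^ 2 - 0))) :=
    ((hinv.const_mul _).add_const _).div (tendsto_const_nhds.sub hinv) (by simpa using hx)
  rw [mul_zero, zero_add, sub_zero, one_div] at hlim
  refine hlim.congr' ?_
  filter_upwards [Filter.eventually_ge_atTop 1] with n hn
  rw [paramRatio_eq (by omega) hn]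
  have hn0 : (n : ℝ) ^ 2 ≠ 0 := by positivity
  rw [← mul_div_mul_right _ _ hn0]
  congr 1
  · field_simp
    ring
  · field_simp

/-- The count that needs `4 ≤ dE`: it fails for `dS = 2`, `dE = 3`. -/
theorem dimSU_add_dimSU_le {dS dE : ℕ} (hS : 2 ≤ dS) (hE : 4 ≤ dE) :
    dimSU dS + dimSU dE ≤ dimSU (dS * dE - (dS + 1)) := by
  obtain ⟨x, rfl⟩ := Nat.exists_eq_add_of_le hS
  obtain ⟨y, rfl⟩ := Nat.exists_eq_add_of_le hE
  have hN : (2 + x) * (4 + y) - (2 + x + 1) = 5 + 3 * x + 2 * y + x * y := by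
    rw [Nat.sub_eq_iff_eq_add (by nlinarith)]
    ring
  rw [hN, dimSU_eq (by omega), dimSU_eq (by omega), dimSU_eq (by omega)]
  have : (2 + x) ^ 2 + (4 + y) ^ 2 ≤ (5 + 3 * x + 2 * y + x * y) ^ 2 := by
    nlinarith [Nat.zero_le (x * y), Nat.zero_le (x * y * x), Nat.zero_le (x * y * y),
      Nat.zero_le ((x * y) ^ 2)]
  have h1 : 1 ≤ (2 + x) ^ 2 := Nat.one_le_pow _ _ (by omega)
  have h2 : 1 ≤ (4 + y) ^ 2 := Nat.one_le_pow _ _ (by omega)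
  omega

/-! ### Frames and generators -/

/-- Unit vectors `a`, `φ` and `ω` with `ω ∈ a^⊥ ⊗ φ^⊥`: the data of a damping process that moves
`a ⊗ φ` towards `ω`. -/
structure IsDampingFrame {dS dE : ℕ} (a : Fin dS → ℂ) (φ : Fin dE → ℂ)
    (ω : Fin dS × Fin dE → ℂ) : Prop where
  system : IsState a
  environment : IsState φ
  target : IsState ω
  orthogonal_system : ∀ k, ∑ i, star (a i) * ω (i, k) = 0
  orthogonal_environment : ∀ i, ∑ k, star (φ k) * ω (i, k) = 0

theorem star_prodVec_dotProduct {dS dE : ℕ} (x : Fin dS → ℂ) (φ : Fin dE → ℂ)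
    (v : Fin dS × Fin dE → ℂ) :
    star (prodVec x φ) ⬝ᵥ v = ∑ i, star (x i) * ∑ k, star (φ k) * v (i, k) := by
  simp only [dotProduct, prodVec, Pi.star_apply, star_mul', Fintype.sum_prod_type, Finset.mul_sum,
    mul_assoc]

theorem star_prodVec_dotProduct_prodVec {dS dE : ℕ} (x y : Fin dS → ℂ) (φ χ : Fin dE → ℂ) :
    star (prodVec x φ) ⬝ᵥ prodVec y χ = (star x ⬝ᵥ y) * (star φ ⬝ᵥ χ) := by
  rw [star_prodVec_dotProduct]
  simp only [dotProduct, prodVec, Pi.star_apply]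
  rw [Finset.sum_mul_sum]
  simp only [Finset.mul_sum]
  exact Finset.sum_congr rfl fun i _ => Finset.sum_congr rfl fun k _ => by ring

/-- The skew-Hermitian generator of the rotation of `a ⊗ φ` into `ω` at unit speed, plus a
generator `Z` that is meant to act on the complement of `ℂ^dS ⊗ φ + ℂ ω`. -/
def dampingGenerator {dS dE : ℕ} (a : Fin dS → ℂ) (φ : Fin dE → ℂ) (ω : Fin dS × Fin dE → ℂ)
    (Z : Matrix (Fin dS × Fin dE) (Fin dS × Fin dE) ℂ) :
    Matrix (Fin dS × Fin dE) (Fin dS × Fin dE) ℂ :=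
  Matrix.vecMulVec ω (star (prodVec a φ)) - Matrix.vecMulVec (prodVec a φ) (star ω) + Z

/-- `Z` is a traceless skew-Hermitian matrix that acts on the orthogonal complement of
`ℂ^dS ⊗ φ + ℂ ω` only. -/
structure IsComplementGenerator {dS dE : ℕ} (φ : Fin dE → ℂ) (ω : Fin dS × Fin dE → ℂ)
    (Z : Matrix (Fin dS × Fin dE) (Fin dS × Fin dE) ℂ) : Prop where
  conjTranspose_eq : Z.conjTranspose = -Z
  trace_eq : Z.trace = 0
  mulVec_prodVec : ∀ x : Fin dS → ℂ, Z.mulVec (prodVec x φ) = 0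
  mulVec_target : Z.mulVec ω = 0

/-! ### Generalised amplitude damping -/

/-- The operator `1 + (η - 1) |a⟩⟨a|` on the system; for a unit vector `a` it multiplies `a` by `η`
and fixes the orthogonal complement of `a`. -/
def contract {dS : ℕ} (a : Fin dS → ℂ) (η : ℝ) : Matrix (Fin dS) (Fin dS) ℂ :=
  1 + ((η : ℂ) - 1) • ketBra a

theorem contract_mulVec {dS : ℕ} (a x : Fin dS → ℂ) (η : ℝ) :
    (contract a η).mulVec x = x + (((η : ℂ) - 1) * (star a ⬝ᵥ x)) • a := by
  rw [contract, Matrix.add_mulVec, Matrix.one_mulVec, Matrix.smul_mulVec, ketBra,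
    Matrix.vecMulVec_mulVec, op_smul_eq_smul, smul_smul]

/-- Generalised amplitude damping of the state `a` into `σ`: a part `1 - η²` of the population of
`a` is moved to `σ`, and the coherences of `a` are multiplied by `η`. -/
def ampDamp {dS : ℕ} (a : Fin dS → ℂ) (σ : Matrix (Fin dS) (Fin dS) ℂ) (η : ℝ) :
    Matrix (Fin dS) (Fin dS) ℂ →ₗ[ℂ] Matrix (Fin dS) (Fin dS) ℂ where
  toFun ρ := contract a η * ρ * contract a η + ((1 - (η : ℂ) ^ 2) * (star a ⬝ᵥ ρ.mulVec a)) • σ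
  map_add' ρ ρ' := by
    rw [Matrix.mul_add, Matrix.add_mul, Matrix.add_mulVec, dotProduct_add, mul_add, add_smul]
    abel
  map_smul' c ρ := by
    rw [Matrix.mul_smul, Matrix.smul_mul, Matrix.smul_mulVec, dotProduct_smul, smul_add,
      smul_smul, RingHom.id_apply, smul_eq_mul, mul_left_comm]

theorem ampDamp_apply {dS : ℕ} (a : Fin dS → ℂ) (σ : Matrix (Fin dS) (Fin dS) ℂ) (η : ℝ)
    (ρ : Matrix (Fin dS) (Fin dS) ℂ) :
    ampDamp a σ η ρ
      = contract a η * ρ * contract a η + ((1 - (η : ℂ) ^ 2) * (star a ⬝ᵥ ρ.mulVec a)) • σ :=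
  rfl

theorem contract_conjTranspose {dS : ℕ} (a : Fin dS → ℂ) (η : ℝ) :
    (contract a η).conjTranspose = contract a η := by
  simp [contract, ketBra, Matrix.conjTranspose_vecMulVec]

theorem star_vecMul_contract {dS : ℕ} (a x : Fin dS → ℂ) (η : ℝ) :
    Matrix.vecMul (star x) (contract a η) = star ((contract a η).mulVec x) := by
  rw [Matrix.star_mulVec, contract_conjTranspose]

theorem contract_mulVec_self {dS : ℕ} {a : Fin dS → ℂ} (ha : IsState a) (η : ℝ) :
    (contract a η).mulVec a = (η : ℂ) • a := by
  rw [contract_mulVec, ha]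
  module

theorem contract_mul_contract {dS : ℕ} {a : Fin dS → ℂ} (ha : IsState a) (η η' : ℝ) :
    contract a η * contract a η' = contract a (η * η') := by
  have hP : ketBra a * ketBra a = ketBra a := by
    rw [ketBra, Matrix.vecMulVec_mul_vecMulVec, ha]
    simp
  simp only [contract, Matrix.add_mul, Matrix.mul_add, Matrix.one_mul, Matrix.mul_one,
    Matrix.smul_mul, Matrix.mul_smul, hP]
  push_cast
  module

section Semigroup

variable {dS : ℕ} {a : Fin dS → ℂ} {σ : Matrix (Fin dS) (Fin dS) ℂ}

theorem ampDamp_one : ampDamp a σ 1 = LinearMap.id := by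
  ext1 ρ
  simp [ampDamp_apply, contract]

/-- Damping maps compose by multiplication of their parameters, because `σ` has no component along
`a` and is therefore a fixed point. -/
theorem ampDamp_comp (ha : IsState a) (hσ : σ.mulVec a = 0) (hσ' : σ.conjTranspose = σ)
    (η η' : ℝ) : ampDamp a σ η ∘ₗ ampDamp a σ η' = ampDamp a σ (η * η') := by
  have hl : ketBra a * σ = 0 := by
    rw [ketBra, Matrix.vecMulVec_mul, ← hσ', ← Matrix.star_mulVec, hσ, star_zero,
      Matrix.vecMulVec_zero]
  have hr : σ * ketBra a = 0 := by
    rw [ketBra, Matrix.mul_vecMulVec, hσ, Matrix.zero_vecMulVec]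
  have hfix : contract a η * σ * contract a η = σ := by
    simp [contract, Matrix.add_mul, Matrix.mul_add, hl, hr]
  refine LinearMap.ext fun ρ => ?_
  have hin : star a ⬝ᵥ (contract a η' * ρ * contract a η').mulVec a
      = (η' : ℂ) ^ 2 * (star a ⬝ᵥ ρ.mulVec a) := by
    rw [← Matrix.mulVec_mulVec, contract_mulVec_self ha, ← Matrix.mulVec_mulVec,
      Matrix.dotProduct_mulVec, star_vecMul_contract, contract_mulVec_self ha, Matrix.mulVec_smul,
      star_smul, smul_dotProduct, dotProduct_smul]
    simp
    ring
  rw [LinearMap.comp_apply, ampDamp_apply, ampDamp_apply, ampDamp_apply, Matrix.mul_add,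
    Matrix.add_mul, Matrix.mul_smul, Matrix.smul_mul, hfix, Matrix.add_mulVec, dotProduct_add, hin,
    Matrix.smul_mulVec, hσ, smul_zero, dotProduct_zero, add_zero]
  have hK : contract a η * (contract a η' * ρ * contract a η') * contract a η
      = contract a (η * η') * ρ * contract a (η * η') := by
    calc _ = (contract a η * contract a η') * ρ * (contract a η' * contract a η) := by
          simp only [Matrix.mul_assoc]
      _ = _ := by rw [contract_mul_contract ha, contract_mul_contract ha, mul_comm η' η]
  rw [hK, add_assoc, ← add_smul]
  congr 2
  push_cast
  ring

theorem ampDamp_bijective (ha : IsState a) (hσ : σ.mulVec a = 0) (hσ' : σ.conjTranspose = σ)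
    {η : ℝ} (hη : η ≠ 0) : Function.Bijective (ampDamp a σ η) := by
  refine Function.bijective_iff_has_inverse.2 ⟨ampDamp a σ η⁻¹, fun ρ => ?_, fun ρ => ?_⟩
  · rw [← LinearMap.comp_apply, ampDamp_comp ha hσ hσ', inv_mul_cancel₀ hη, ampDamp_one]
    rfl
  · rw [← LinearMap.comp_apply, ampDamp_comp ha hσ hσ', mul_inv_cancel₀ hη, ampDamp_one]
    rfl

theorem ampDamp_isTP (ha : IsState a) (hσ : σ.trace = 1) (η : ℝ) : IsTP (ampDamp a σ η) := by
  intro ρ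
  have h : (ketBra a * ρ).trace = star a ⬝ᵥ ρ.mulVec a := by
    rw [ketBra, Matrix.vecMulVec_mul, Matrix.trace_vecMulVec, Matrix.dotProduct_mulVec,
      dotProduct_comm]
  rw [ampDamp_apply, Matrix.trace_add, Matrix.trace_smul, hσ, Matrix.mul_assoc,
    Matrix.trace_mul_comm, Matrix.mul_assoc, contract_mul_contract ha, Matrix.trace_mul_comm,
    contract, Matrix.add_mul, Matrix.trace_add, Matrix.smul_mul, Matrix.trace_smul, h, Matrix.one_mul]
  simp
  ring

theorem ampDamp_isCP (hσ : σ.PosSemidef) {η : ℝ} (hη : η ^ 2 ≤ 1) : IsCP (ampDamp a σ η) := by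
  intro n X hX
  let K : Matrix (Fin dS × Fin n) (Fin dS × Fin n) ℂ := contract a η ⊗ₖ 1
  let B : Matrix (Fin n) (Fin dS × Fin n) ℂ :=
    Matrix.of fun l p => if p.2 = l then star (a p.1) else 0
  -- `B X B†` is the block `(⟨a| ⊗ 1) X (|a⟩ ⊗ 1)`.
  have hK : (K * X * K.conjTranspose).PosSemidef := hX.mul_mul_conjTranspose_same K
  have hB : (σ ⊗ₖ (B * X * B.conjTranspose)).PosSemidef :=
    hσ.kronecker (hX.mul_mul_conjTranspose_same B)
  have hc : (0 : ℂ) ≤ 1 - (η : ℂ) ^ 2 := by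
    rw [sub_nonneg]
    exact_mod_cast hη
  convert hK.add (hB.smul hc) using 1
  ext ⟨i, k⟩ ⟨j, l⟩
  simp only [amplify, Matrix.of_apply, ampDamp_apply, Matrix.add_apply, Matrix.smul_apply]
  congr 1
  · have hKc : K.conjTranspose = K := by
      simp [K, Matrix.conjTranspose_kronecker, contract_conjTranspose]
    rw [hKc]
    simp [K, Matrix.mul_apply, Fintype.sum_prod_type, Matrix.kroneckerMap_apply, Matrix.one_apply]
  · simp [B, Matrix.mul_apply, Fintype.sum_prod_type, Matrix.kroneckerMap_apply, dotProduct,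
      Matrix.mulVec, Finset.mul_sum, Finset.sum_mul, apply_ite (starRingEnd ℂ)]
    rw [Finset.sum_comm]
    exact Finset.sum_congr rfl fun _ _ => Finset.sum_congr rfl fun _ _ => by ring

end Semigroup

/-! ### The joint evolution and the reduced dynamics -/

theorem evolution_I_smul {ι : Type} [Fintype ι] [DecidableEq ι] (A : Matrix ι ι ℂ) (r : ℝ) :
    evolution (Complex.I • A) r = NormedSpace.exp ((r : ℂ) • A) := by
  have h : -(Complex.I * (r : ℂ)) * Complex.I = r := by
    linear_combination (-(r : ℂ)) * Complex.I_mul_I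
  rw [evolution, smul_smul, h]

namespace IsDampingFrame

variable {dS dE : ℕ} {a : Fin dS → ℂ} {φ : Fin dE → ℂ} {ω : Fin dS × Fin dE → ℂ}

theorem prodVec_orthogonal (h : IsDampingFrame a φ ω) (x : Fin dS → ℂ) :
    star (prodVec x φ) ⬝ᵥ ω = 0 := by
  simp only [star_prodVec_dotProduct, h.orthogonal_environment, mul_zero, Finset.sum_const_zero]

theorem target_orthogonal (h : IsDampingFrame a φ ω) (x : Fin dS → ℂ) :
    star ω ⬝ᵥ prodVec x φ = 0 := by
  rw [Matrix.star_dotProduct, h.prodVec_orthogonal, star_zero]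

theorem isState_prodVec (h : IsDampingFrame a φ ω) : IsState (prodVec a φ) := by
  rw [IsState, star_prodVec_dotProduct_prodVec, h.system, h.environment, one_mul]

variable {Z : Matrix (Fin dS × Fin dE) (Fin dS × Fin dE) ℂ}

theorem dampingGenerator_mulVec_prodVec (h : IsDampingFrame a φ ω)
    (hZ : IsComplementGenerator φ ω Z) (x : Fin dS → ℂ) :
    (dampingGenerator a φ ω Z).mulVec (prodVec x φ) = (star a ⬝ᵥ x) • ω := by
  rw [dampingGenerator, Matrix.add_mulVec, Matrix.sub_mulVec, hZ.mulVec_prodVec,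
    Matrix.vecMulVec_mulVec, Matrix.vecMulVec_mulVec, h.target_orthogonal,
    star_prodVec_dotProduct_prodVec, h.environment]
  simp

theorem dampingGenerator_mulVec_target (h : IsDampingFrame a φ ω)
    (hZ : IsComplementGenerator φ ω Z) :
    (dampingGenerator a φ ω Z).mulVec ω = -prodVec a φ := by
  rw [dampingGenerator, Matrix.add_mulVec, Matrix.sub_mulVec, hZ.mulVec_target,
    Matrix.vecMulVec_mulVec, Matrix.vecMulVec_mulVec, h.target, h.prodVec_orthogonal]
  simp

theorem dampingGenerator_conjTranspose (hZ : IsComplementGenerator φ ω Z) :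
    (dampingGenerator a φ ω Z).conjTranspose = -dampingGenerator a φ ω Z := by
  rw [dampingGenerator, Matrix.conjTranspose_add, Matrix.conjTranspose_sub,
    Matrix.conjTranspose_vecMulVec, Matrix.conjTranspose_vecMulVec, star_star, star_star,
    hZ.conjTranspose_eq]
  abel

theorem dampingGenerator_trace (h : IsDampingFrame a φ ω) (hZ : IsComplementGenerator φ ω Z) :
    (dampingGenerator a φ ω Z).trace = 0 := by
  rw [dampingGenerator, Matrix.trace_add, Matrix.trace_sub, hZ.trace_eq, Matrix.trace_vecMulVec,
    Matrix.trace_vecMulVec, dotProduct_comm, h.prodVec_orthogonal, dotProduct_comm,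
    h.target_orthogonal]
  simp

/-- The joint evolution of `x ⊗ φ`. It is read off from eigenvectors: the generator kills
`x ⊗ φ - ⟨a, x⟩ a ⊗ φ` and has the eigenvalues `∓ i` at `a ⊗ φ ± i ω`. -/
theorem evolution_mulVec_prodVec (h : IsDampingFrame a φ ω) (hZ : IsComplementGenerator φ ω Z)
    (r : ℝ) (x : Fin dS → ℂ) :
    (evolution (Complex.I • dampingGenerator a φ ω Z) r).mulVec (prodVec x φ)
      = prodVec ((contract a (Real.cos r)).mulVec x) φ
        + ((Real.sin r : ℂ) * (star a ⬝ᵥ x)) • ω := by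
  rw [evolution_I_smul]
  set G := dampingGenerator a φ ω Z with hG
  set c := star a ⬝ᵥ x with hc
  have hGx := h.dampingGenerator_mulVec_prodVec hZ x
  have hGa := h.dampingGenerator_mulVec_prodVec hZ a
  have hGω := h.dampingGenerator_mulVec_target hZ
  rw [h.system, one_smul] at hGa
  rw [← hG] at hGx hGa hGω
  rw [← hc] at hGx
  have hplus : (((r : ℂ) • G).mulVec (prodVec a φ + Complex.I • ω))
      = (-(r * Complex.I)) • (prodVec a φ + Complex.I • ω) := by
    rw [Matrix.smul_mulVec, Matrix.mulVec_add, Matrix.mulVec_smul, hGa, hGω]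
    match_scalars <;> ring_nf; simp
  have hminus : (((r : ℂ) • G).mulVec (prodVec a φ - Complex.I • ω))
      = (r * Complex.I) • (prodVec a φ - Complex.I • ω) := by
    rw [Matrix.smul_mulVec, Matrix.mulVec_sub, Matrix.mulVec_smul, hGa, hGω]
    match_scalars <;> ring_nf; simp
  have hzero : (((r : ℂ) • G).mulVec (prodVec x φ - c • prodVec a φ))
      = (0 : ℂ) • (prodVec x φ - c • prodVec a φ) := by
    rw [Matrix.smul_mulVec, Matrix.mulVec_sub, Matrix.mulVec_smul, hGa, hGx]
    simp
  have hdec : prodVec x φ = (prodVec x φ - c • prodVec a φ)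
      + (c / 2) • (prodVec a φ + Complex.I • ω) + (c / 2) • (prodVec a φ - Complex.I • ω) := by
    module
  have hK : prodVec ((contract a (Real.cos r)).mulVec x) φ
      = prodVec x φ + ((Complex.cos r - 1) * c) • prodVec a φ := by
    rw [contract_mulVec]
    ext p
    simp [prodVec]
    ring
  rw [hdec, Matrix.mulVec_add, Matrix.mulVec_add, Matrix.mulVec_smul, Matrix.mulVec_smul,
    exp_mulVec_of_eigenvector hplus, exp_mulVec_of_eigenvector hminus,
    exp_mulVec_of_eigenvector hzero, hK, Complex.exp_zero, ← neg_mul, Complex.exp_mul_I,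
    Complex.exp_mul_I, Complex.cos_neg, Complex.sin_neg, Complex.ofReal_sin]
  match_scalars <;> ring_nf; simp

theorem evolution_mulVec_prodVec_self (h : IsDampingFrame a φ ω)
    (hZ : IsComplementGenerator φ ω Z) (r : ℝ) :
    (evolution (Complex.I • dampingGenerator a φ ω Z) r).mulVec (prodVec a φ)
      = (Real.cos r : ℂ) • prodVec a φ + (Real.sin r : ℂ) • ω := by
  rw [h.evolution_mulVec_prodVec hZ, contract_mulVec_self h.system, h.system, mul_one]
  congr 1
  ext p
  simp [prodVec, mul_assoc]

/-- The partial trace has no cross terms, since `ω` lies in `ℂ^dS ⊗ φ^⊥`. -/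
theorem traceE_vecMulVec (h : IsDampingFrame a φ ω) (x y : Fin dS → ℂ) (c d : ℂ) :
    traceE (Matrix.vecMulVec (prodVec x φ + c • ω) (star (prodVec y φ + d • ω)))
      = Matrix.vecMulVec x (star y) + (c * star d) • traceE (ketBra ω) := by
  have hE : ∑ k, φ k * star (φ k) = 1 := by
    have := h.environment
    rw [IsState, dotProduct_comm] at this
    exact this
  have hω : ∀ i, ∑ k, φ k * star (ω (i, k)) = 0 := by
    intro i
    have := congrArg star (h.orthogonal_environment i)
    simpa [mul_comm] using this
  ext i j
  have h1 : ∀ k, (prodVec x φ + c • ω) (i, k) * star ((prodVec y φ + d • ω) (j, k))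
      = x i * star (y j) * (φ k * star (φ k)) + x i * star d * (φ k * star (ω (j, k)))
        + c * star (y j) * (star (φ k) * ω (i, k)) + c * star d * (ω (i, k) * star (ω (j, k))) := by
    intro k
    simp [prodVec]
    ring
  simp only [traceE, Matrix.of_apply, Matrix.vecMulVec_apply, Pi.star_apply, h1,
    Finset.sum_add_distrib, ← Finset.mul_sum, hE, hω, h.orthogonal_environment, Matrix.add_apply,
    Matrix.smul_apply, ketBra, smul_eq_mul]
  ring

/-- The reduced dynamics is generalised amplitude damping. By linearity it is enough to look at
`|x⟩⟨y|`. -/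
theorem dynMap_eq_ampDamp (h : IsDampingFrame a φ ω) (hZ : IsComplementGenerator φ ω Z) (r : ℝ) :
    dynMap (Complex.I • dampingGenerator a φ ω Z) φ r
      = ampDamp a (traceE (ketBra ω)) (Real.cos r) := by
  refine Matrix.ext_linearMap ℂ fun i j => LinearMap.ext_ring ?_
  have hs : Matrix.single i j (1 : ℂ) = Matrix.vecMulVec (Pi.single i 1) (star (Pi.single j 1)) := by
    rw [← Pi.single_star, star_one, Matrix.single_eq_single_vecMulVec_single]
  have hk : ∀ x y : Fin dS → ℂ, Matrix.vecMulVec x (star y) ⊗ₖ ketBra φ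
      = Matrix.vecMulVec (prodVec x φ) (star (prodVec y φ)) := by
    intro x y
    ext p q
    simp [ketBra, Matrix.vecMulVec_apply, prodVec]
    ring
  rw [LinearMap.comp_apply, LinearMap.comp_apply,
    show Matrix.singleLinearMap ℂ i j (1 : ℂ) = Matrix.single i j 1 from rfl, hs]
  generalize (Pi.single i 1 : Fin dS → ℂ) = x
  generalize (Pi.single j 1 : Fin dS → ℂ) = y
  change traceE (_ * (Matrix.vecMulVec x (star y) ⊗ₖ ketBra φ) * _) = _
  rw [hk, Matrix.mul_vecMulVec, Matrix.vecMulVec_mul, ← Matrix.star_mulVec,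
    h.evolution_mulVec_prodVec hZ, h.evolution_mulVec_prodVec hZ, h.traceE_vecMulVec,
    ampDamp_apply, Matrix.mul_vecMulVec, Matrix.vecMulVec_mul, star_vecMul_contract,
    Matrix.vecMulVec_mulVec]
  congr 2
  rw [Matrix.star_dotProduct a y]
  have hcs : (Real.sin r : ℂ) ^ 2 = 1 - (Real.cos r : ℂ) ^ 2 := by
    rw [← Complex.ofReal_pow, Real.sin_sq]
    push_cast
    ring
  rw [← hcs, star_mul', star_star, Complex.star_def, Complex.conj_ofReal]
  simp
  ring

theorem traceE_ketBra_mulVec (h : IsDampingFrame a φ ω) :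
    (traceE (ketBra ω)).mulVec a = 0 := by
  ext i
  have h1 : ∀ k, ∑ j, star (ω (j, k)) * a j = 0 := by
    intro k
    have := congrArg star (h.orthogonal_system k)
    simpa [mul_comm] using this
  simp only [Matrix.mulVec, dotProduct, traceE, ketBra, Matrix.of_apply, Matrix.vecMulVec_apply,
    Finset.sum_mul, Pi.star_apply]
  rw [Finset.sum_comm]
  simp only [mul_assoc, ← Finset.mul_sum, h1]
  simp

theorem traceE_ketBra_posSemidef (ω : Fin dS × Fin dE → ℂ) : (traceE (ketBra ω)).PosSemidef := by
  let W : Matrix (Fin dS) (Fin dE) ℂ := Matrix.of fun i k => ω (i, k)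
  exact Matrix.posSemidef_self_mul_conjTranspose W

theorem traceE_ketBra_trace (h : IsDampingFrame a φ ω) : (traceE (ketBra ω)).trace = 1 := by
  have := h.target
  rw [IsState, dotProduct_comm, dotProduct, Fintype.sum_prod_type] at this
  exact this

/-- `a ⊗ φ` is mapped to `cos t • (a ⊗ φ) + sin t • ω`, which has Schmidt rank at least two. -/
theorem isEntangling (h : IsDampingFrame a φ ω) (hZ : IsComplementGenerator φ ω Z) {t : ℝ}
    (hc : Real.cos t ≠ 0) (hs : Real.sin t ≠ 0) :
    IsEntangling (evolution (Complex.I • dampingGenerator a φ ω Z) t) := by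
  refine ⟨a, φ, h.system, h.environment, ?_⟩
  rintro ⟨ψ', φ', hU⟩
  rw [h.evolution_mulVec_prodVec_self hZ] at hU
  have hc' : (Real.cos t : ℂ) ≠ 0 := by exact_mod_cast hc
  have hs' : (Real.sin t : ℂ) ≠ 0 := by exact_mod_cast hs
  -- The product form forces `φ'` to be proportional to `φ`.
  have hφ' : ∀ k, (Real.cos t : ℂ) * φ k = (star a ⬝ᵥ ψ') * φ' k := by
    intro k
    have h1 : ∑ i, star (a i) * ((Real.cos t : ℂ) • prodVec a φ + (Real.sin t : ℂ) • ω) (i, k)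
        = (Real.cos t : ℂ) * φ k * (star a ⬝ᵥ a)
          + (Real.sin t : ℂ) * ∑ i, star (a i) * ω (i, k) := by
      simp only [dotProduct, Finset.mul_sum, ← Finset.sum_add_distrib, Pi.add_apply, Pi.smul_apply,
        smul_eq_mul, prodVec, Pi.star_apply]
      exact Finset.sum_congr rfl fun i _ => by ring
    rw [h.orthogonal_system, h.system, mul_zero, add_zero, mul_one] at h1
    rw [← h1, hU, dotProduct, Finset.sum_mul]
    exact Finset.sum_congr rfl fun i _ => by simp [prodVec, mul_assoc]
  have hd : star a ⬝ᵥ ψ' ≠ 0 := by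
    intro h0
    have hφ0 : φ = 0 := by
      ext k
      have := hφ' k
      rw [h0, zero_mul] at this
      exact (mul_eq_zero.1 this).resolve_left hc'
    have := h.environment
    rw [IsState, hφ0] at this
    simp at this
  -- `ω` then lies in `ℂ^dS ⊗ φ`, to which it is orthogonal.
  obtain ⟨x, hx⟩ : ∃ x : Fin dS → ℂ, ω = prodVec x φ := by
    refine ⟨fun i => (Real.sin t : ℂ)⁻¹ * (Real.cos t * (star a ⬝ᵥ ψ')⁻¹ * ψ' i
      - Real.cos t * a i), ?_⟩
    ext ⟨i, k⟩
    have h2 := congrFun hU (i, k)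
    simp only [Pi.add_apply, Pi.smul_apply, smul_eq_mul, prodVec] at h2 ⊢
    have h3 : φ' k = (star a ⬝ᵥ ψ')⁻¹ * (Real.cos t * φ k) := by
      rw [hφ' k, inv_mul_cancel_left₀ hd]
    rw [h3] at h2
    have h4 : (Real.sin t : ℂ) * ω (i, k)
        = (Real.cos t * (star a ⬝ᵥ ψ')⁻¹ * ψ' i - Real.cos t * a i) * φ k := by
      linear_combination h2
    rw [mul_assoc, ← h4, inv_mul_cancel_left₀ hs']
  have h5 := h.target
  rw [IsState] at h5
  nth_rw 2 [hx] at h5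
  rw [h.target_orthogonal] at h5
  exact zero_ne_one h5

/-- The cosine is positive and decreasing on `[s, s + t] ⊆ [0, π / 2)`, so the intermediate maps are
damping maps with a parameter in `(0, 1]`. -/
theorem evolution_mem_cpUnitaries (h : IsDampingFrame a φ ω) (hZ : IsComplementGenerator φ ω Z)
    {s t : ℝ} (hs : 0 ≤ s) (ht : 0 < t) (hst : s + t < Real.pi / 2) :
    evolution (Complex.I • dampingGenerator a φ ω Z) t
      ∈ cpUnitaries ((Real.cos s : ℂ) • prodVec a φ + (Real.sin s : ℂ) • ω) := by
  have hcos : ∀ r, 0 ≤ r → r < Real.pi / 2 → 0 < Real.cos r := fun r h0 h1 =>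
    Real.cos_pos_of_mem_Ioo ⟨by linarith [Real.pi_pos], h1⟩
  have hG := dampingGenerator_conjTranspose (a := a) hZ
  refine ⟨?_, h.isEntangling hZ (hcos t ht.le (by linarith)).ne'
    (Real.sin_pos_of_pos_of_lt_pi ht (by linarith [Real.pi_pos])).ne', ?_⟩
  · rw [evolution_I_smul]
    refine exp_mem_specialUnitaryGroup ?_ ?_
    · rw [Matrix.conjTranspose_smul, hG]
      simp
    · rw [Matrix.trace_smul, h.dampingGenerator_trace hZ, smul_zero]
  · have hσ := h.traceE_ketBra_mulVec
    have hpsd := traceE_ketBra_posSemidef ω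
    have hs0 := hcos s hs (by linarith)
    refine ⟨_, t, s, a, φ, ?_, ht, rfl, hs, h.system, h.environment,
      (h.evolution_mulVec_prodVec_self hZ s).symm, ?_, ?_⟩
    · rw [Matrix.IsHermitian, Matrix.conjTranspose_smul, hG]
      simp
    · rw [h.dynMap_eq_ampDamp hZ]
      exact ampDamp_bijective h.system hσ hpsd.1 hs0.ne'
    · intro τ hτ hτt
      refine ⟨ampDamp a (traceE (ketBra ω)) (Real.cos (s + τ) / Real.cos s), ampDamp_isCP hpsd ?_,
        ampDamp_isTP h.system h.traceE_ketBra_trace _, ?_⟩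
      · have h0 := hcos (s + τ) (by linarith) (by linarith)
        have h1 : Real.cos (s + τ) ≤ Real.cos s :=
          Real.cos_le_cos_of_nonneg_of_le_pi hs (by linarith [Real.pi_pos]) (by linarith)
        exact pow_le_one₀ (div_nonneg h0.le hs0.le) ((div_le_one hs0).2 h1)
      · rw [h.dynMap_eq_ampDamp hZ, h.dynMap_eq_ampDamp hZ, ampDamp_comp h.system hσ hpsd.1,
          div_mul_cancel₀ _ hs0.ne']

end IsDampingFrame

/-! ### A Schmidt pair of the joint state -/

theorem exists_isState_smul {ι : Type} [Fintype ι] {v : ι → ℂ} (hv : v ≠ 0) :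
    ∃ r : ℝ, IsState ((r : ℂ) • v) := by
  have h0 : 0 < star v ⬝ᵥ v := Matrix.dotProduct_star_self_pos_iff.2 hv
  obtain ⟨x, hx0, hx⟩ : ∃ x : ℝ, 0 < x ∧ star v ⬝ᵥ v = x := by
    obtain ⟨h1, h2⟩ := Complex.pos_iff.1 h0
    exact ⟨_, h1, Complex.ext rfl (by simpa using h2.symm)⟩
  refine ⟨(Real.sqrt x)⁻¹, ?_⟩
  rw [IsState, star_smul, smul_dotProduct, dotProduct_smul, hx, Complex.star_def,
    Complex.conj_ofReal, smul_eq_mul, smul_eq_mul, ← Complex.ofReal_mul, ← Complex.ofReal_mul]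
  have : (Real.sqrt x)⁻¹ * ((Real.sqrt x)⁻¹ * x) = 1 := by
    have h2 := Real.mul_self_sqrt hx0.le
    have h3 := (Real.sqrt_pos.2 hx0).ne'
    field_simp
    linarith
  rw [this, Complex.ofReal_one]

theorem exists_isState_orthogonal {d : ℕ} (hd : 2 ≤ d) (a : Fin d → ℂ) :
    ∃ b : Fin d → ℂ, IsState b ∧ star a ⬝ᵥ b = 0 := by
  have hker : LinearMap.ker (dotProductBilin ℂ ℂ (star a)) ≠ ⊥ :=
    LinearMap.ker_ne_bot_of_finrank_lt (by simp; omega)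
  obtain ⟨v, hv, hv0⟩ := Submodule.exists_mem_ne_zero_of_ne_bot hker
  obtain ⟨r, hr⟩ := exists_isState_smul hv0
  refine ⟨_, hr, ?_⟩
  have : star a ⬝ᵥ v = 0 := hv
  rw [dotProduct_smul, this, smul_zero]

/-- Every state is a rotation of a product vector `a ⊗ φ` towards some `ω ∈ a^⊥ ⊗ φ^⊥`, by an
angle below `π / 2`. Here `a` is an eigenvector with positive eigenvalue of the reduced state of the
system, `φ` is its Schmidt partner, and the cosine of the angle is their Schmidt coefficient. -/
theorem exists_isDampingFrame {dS dE : ℕ} (hS : 2 ≤ dS) (hE : 2 ≤ dE)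
    {Φ : Fin dS × Fin dE → ℂ} (hΦ : IsState Φ) :
    ∃ (a : Fin dS → ℂ) (φ : Fin dE → ℂ) (ω : Fin dS × Fin dE → ℂ) (s : ℝ),
      IsDampingFrame a φ ω ∧ 0 ≤ s ∧ s < Real.pi / 2 ∧
        Φ = (Real.cos s : ℂ) • prodVec a φ + (Real.sin s : ℂ) • ω := by
  let M : Matrix (Fin dS) (Fin dE) ℂ := Matrix.of fun i k => Φ (i, k)
  have htr : (M * M.conjTranspose).trace = 1 := by
    rw [IsState, dotProduct_comm, dotProduct, Fintype.sum_prod_type] at hΦ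
    exact hΦ
  have hM0 : M * M.conjTranspose ≠ 0 := by
    intro h
    rw [h, Matrix.trace_zero] at htr
    exact zero_ne_one htr
  obtain ⟨v, x, hx0, hv0, hv⟩ :=
    (Matrix.isHermitian_mul_conjTranspose_self M).exists_eigenvector_of_ne_zero hM0
  obtain ⟨r, hr⟩ := exists_isState_smul hv0
  set a : Fin dS → ℂ := (r : ℂ) • v with ha
  have hMa : (M * M.conjTranspose).mulVec a = (x : ℂ) • a := by
    rw [ha, Matrix.mulVec_smul, hv, smul_comm]
    rfl
  -- `y` is the unnormalised Schmidt partner of `a`.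
  set y : Fin dE → ℂ := Matrix.vecMul (star a) M with hy
  have hystar : star y = M.conjTranspose.mulVec a := by
    rw [hy, Matrix.star_vecMul, star_star]
  have hyy : star y ⬝ᵥ y = x := by
    rw [dotProduct_comm, hystar, hy, ← Matrix.dotProduct_mulVec, Matrix.mulVec_mulVec, hMa,
      dotProduct_smul, hr, smul_eq_mul, mul_one]
  have hxpos : 0 < x := by
    have h1 : (0 : ℂ) ≤ (x : ℂ) := hyy ▸ dotProduct_star_self_nonneg y
    exact lt_of_le_of_ne (by exact_mod_cast h1) hx0.symm
  set c := Real.sqrt x with hc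
  have hcpos : 0 < c := Real.sqrt_pos.2 hxpos
  have hcc : (c : ℂ) * c = x := by exact_mod_cast Real.mul_self_sqrt hxpos.le
  have hc0 : (c : ℂ) ≠ 0 := by exact_mod_cast hcpos.ne'
  set φ : Fin dE → ℂ := (c : ℂ)⁻¹ • y with hφ
  have hφstate : IsState φ := by
    rw [IsState, hφ, star_smul, smul_dotProduct, dotProduct_smul, hyy, star_inv₀, Complex.star_def,
      Complex.conj_ofReal, ← hcc, smul_eq_mul, smul_eq_mul]
    field_simp
  have hleft : ∀ k, ∑ i, star (a i) * Φ (i, k) = c * φ k := by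
    intro k
    rw [hφ, Pi.smul_apply, smul_eq_mul, mul_inv_cancel_left₀ hc0]
    rfl
  have hright : ∀ i, ∑ k, star (φ k) * Φ (i, k) = c * a i := by
    intro i
    have h1 : M.mulVec (star φ) = (c : ℂ) • a := by
      rw [hφ, star_smul, hystar, Matrix.mulVec_smul, Matrix.mulVec_mulVec, hMa, smul_smul, ← hcc,
        star_inv₀, Complex.star_def, Complex.conj_ofReal, inv_mul_cancel_left₀ hc0]
    rw [← smul_eq_mul, ← Pi.smul_apply, ← h1]
    simp only [Matrix.mulVec, dotProduct, Pi.star_apply, M, Matrix.of_apply, mul_comm]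
  set Ω : Fin dS × Fin dE → ℂ := Φ - (c : ℂ) • prodVec a φ with hΩ
  have hΩS : ∀ k, ∑ i, star (a i) * Ω (i, k) = 0 := by
    intro k
    have h1 : ∑ i, star (a i) * a i = 1 := hr
    have h2 : ∀ i, star (a i) * Ω (i, k)
        = star (a i) * Φ (i, k) - (star (a i) * a i) * (c * φ k) := by
      intro i
      simp [hΩ, prodVec]
      ring
    simp only [h2]
    rw [Finset.sum_sub_distrib, hleft, ← Finset.sum_mul, h1, one_mul, sub_self]
  have hΩE : ∀ i, ∑ k, star (φ k) * Ω (i, k) = 0 := by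
    intro i
    have h1 : ∑ k, star (φ k) * φ k = 1 := hφstate
    have h2 : ∀ k, star (φ k) * Ω (i, k)
        = star (φ k) * Φ (i, k) - (star (φ k) * φ k) * (c * a i) := by
      intro k
      simp [hΩ, prodVec]
      ring
    simp only [h2]
    rw [Finset.sum_sub_distrib, hright, ← Finset.sum_mul, h1, one_mul, sub_self]
  have hpp : star (prodVec a φ) ⬝ᵥ prodVec a φ = 1 := by
    rw [star_prodVec_dotProduct_prodVec, hr, hφstate, one_mul]
  have hpΩ : star (prodVec a φ) ⬝ᵥ Ω = 0 := by
    simp only [star_prodVec_dotProduct, hΩE, mul_zero, Finset.sum_const_zero]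
  have hΩp : star Ω ⬝ᵥ prodVec a φ = 0 := by
    rw [Matrix.star_dotProduct, hpΩ, star_zero]
  have hΦdec : Φ = (c : ℂ) • prodVec a φ + Ω := by
    rw [hΩ]
    abel
  have hΩΩ : star Ω ⬝ᵥ Ω = 1 - (c : ℂ) ^ 2 := by
    have h1 : star Φ ⬝ᵥ Φ = 1 := hΦ
    rw [hΦdec, star_add, add_dotProduct, dotProduct_add, dotProduct_add, star_smul,
      smul_dotProduct, smul_dotProduct, dotProduct_smul, dotProduct_smul, hpp, hpΩ, hΩp,
      Complex.star_def, Complex.conj_ofReal] at h1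
    simp only [smul_eq_mul, mul_zero, mul_one, add_zero, zero_add] at h1
    rw [← h1]
    ring
  have hc1 : c ^ 2 ≤ 1 := by
    have h1 : (0 : ℂ) ≤ 1 - (c : ℂ) ^ 2 := hΩΩ ▸ dotProduct_star_self_nonneg Ω
    rw [sub_nonneg] at h1
    exact_mod_cast h1
  have hc1' : c ≤ 1 := by nlinarith
  have hcos : Real.cos (Real.arccos c) = c := Real.cos_arccos (by linarith) hc1'
  have hs0 := Real.arccos_nonneg c
  have hs1 : Real.arccos c < Real.pi / 2 := Real.arccos_lt_pi_div_two.2 hcpos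
  have hsin : Real.sin (Real.arccos c) = Real.sqrt (1 - c ^ 2) := Real.sin_arccos c
  -- If `Φ` is a product vector, then `s = 0` and any `ω` in `a^⊥ ⊗ φ^⊥` will do.
  by_cases hΩ0 : Ω = 0
  · obtain ⟨b, hb, hab⟩ := exists_isState_orthogonal hS a
    obtain ⟨χ, hχ, hφχ⟩ := exists_isState_orthogonal hE φ
    have hce : c ^ 2 = 1 := by
      rw [hΩ0, dotProduct_zero] at hΩΩ
      have h1 : (c : ℂ) ^ 2 = 1 := (sub_eq_zero.1 hΩΩ.symm).symm
      exact_mod_cast h1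
    refine ⟨a, φ, prodVec b χ, Real.arccos c, ⟨hr, hφstate, ?_, fun k => ?_, fun i => ?_⟩, hs0, hs1,
      ?_⟩
    · rw [IsState, star_prodVec_dotProduct_prodVec, hb, hχ, one_mul]
    · have h1 : ∑ i, star (a i) * b i = 0 := hab
      simp only [prodVec, ← mul_assoc]
      rw [← Finset.sum_mul, h1, zero_mul]
    · have h1 : ∑ k, star (φ k) * χ k = 0 := hφχ
      simp only [prodVec, mul_left_comm _ (b i)]
      rw [← Finset.mul_sum, h1, mul_zero]
    · rw [hcos, hsin, hce, sub_self, Real.sqrt_zero, Complex.ofReal_zero, zero_smul, add_zero]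
      rw [hΩ0, add_zero] at hΦdec
      exact hΦdec
  · have hpos : 0 < 1 - c ^ 2 := by
      have h1 : 0 < star Ω ⬝ᵥ Ω := Matrix.dotProduct_star_self_pos_iff.2 hΩ0
      rw [hΩΩ] at h1
      exact_mod_cast h1
    set w := Real.sqrt (1 - c ^ 2) with hw
    have hw0 : (w : ℂ) ≠ 0 := by exact_mod_cast (Real.sqrt_pos.2 hpos).ne'
    have hww : (w : ℂ) * w = 1 - (c : ℂ) ^ 2 := by exact_mod_cast Real.mul_self_sqrt hpos.le
    refine ⟨a, φ, (w : ℂ)⁻¹ • Ω, Real.arccos c, ⟨hr, hφstate, ?_, fun k => ?_, fun i => ?_⟩, hs0,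
      hs1, ?_⟩
    · rw [IsState, star_smul, smul_dotProduct, dotProduct_smul, hΩΩ, star_inv₀, Complex.star_def,
        Complex.conj_ofReal, ← hww, smul_eq_mul, smul_eq_mul]
      field_simp
    · simp only [Pi.smul_apply, smul_eq_mul, mul_left_comm _ (w : ℂ)⁻¹]
      rw [← Finset.mul_sum, hΩS, mul_zero]
    · simp only [Pi.smul_apply, smul_eq_mul, mul_left_comm _ (w : ℂ)⁻¹]
      rw [← Finset.mul_sum, hΩE, mul_zero]
    · rw [hcos, hsin, smul_inv_smul₀ hw0]
      exact hΦdec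

/-! ### The dimension of the set of unitaries -/

/-- `ℂ^dS ⊗ φ + ℂ ω` has dimension at most `dS + 1`, so `ℂ^n` embeds isometrically into its
orthogonal complement for `n = dS * dE - (dS + 1)`. -/
theorem exists_isometry_orthogonal {dS dE : ℕ} (φ : Fin dE → ℂ) (ω : Fin dS × Fin dE → ℂ) :
    ∃ J : Matrix (Fin dS × Fin dE) (Fin (dS * dE - (dS + 1))) ℂ,
      J.conjTranspose * J = 1 ∧ (∀ x : Fin dS → ℂ, J.conjTranspose.mulVec (prodVec x φ) = 0) ∧
        J.conjTranspose.mulVec ω = 0 := by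
  let L : ((Fin dS → ℂ) × ℂ) →ₗ[ℂ] EuclideanSpace ℂ (Fin dS × Fin dE) :=
    { toFun := fun z => WithLp.toLp 2 (prodVec z.1 φ + z.2 • ω)
      map_add' := by
        intro z w
        ext p
        simp [prodVec]
        ring
      map_smul' := by
        intro c z
        ext p
        simp [prodVec]
        ring }
  have hrank : dS * dE - (dS + 1) ≤ Module.finrank ℂ (LinearMap.range L)ᗮ := by
    have h1 := Submodule.finrank_add_finrank_orthogonal (LinearMap.range L)
    have h2 := LinearMap.finrank_range_le L
    simp at h1 h2
    omega
  let b := stdOrthonormalBasis ℂ (LinearMap.range L)ᗮ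
  let e : Fin (dS * dE - (dS + 1)) → EuclideanSpace ℂ (Fin dS × Fin dE) :=
    fun l => (b (Fin.castLE hrank l) : EuclideanSpace ℂ (Fin dS × Fin dE))
  have he : Orthonormal ℂ e :=
    (b.orthonormal.comp _ (Fin.castLE_injective hrank)).comp_linearIsometry
      (LinearMap.range L)ᗮ.subtypeₗᵢ
  let J : Matrix (Fin dS × Fin dE) (Fin (dS * dE - (dS + 1))) ℂ := Matrix.of fun p l => e l p
  have hJ : ∀ (v : Fin dS × Fin dE → ℂ) l,
      J.conjTranspose.mulVec v l = inner ℂ (e l) (WithLp.toLp 2 v) := by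
    intro v l
    simp [J, Matrix.mulVec, dotProduct, PiLp.inner_apply, mul_comm]
  have horth : ∀ z l, inner ℂ (e l) (L z) = 0 := by
    intro z l
    exact Submodule.inner_left_of_mem_orthogonal (LinearMap.mem_range_self L z)
      (b (Fin.castLE hrank l)).2
  refine ⟨J, ?_, fun x => ?_, ?_⟩
  · ext l m
    rw [Matrix.one_apply, ← orthonormal_iff_ite.1 he l m]
    exact hJ (e m) l
  · ext l
    rw [hJ]
    simpa [L] using horth (x, 0) l
  · ext l
    rw [hJ]
    have hp : prodVec (0 : Fin dS → ℂ) φ = 0 := by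
      ext p
      simp [prodVec]
    simpa [L, hp] using horth (0, 1) l

theorem isComplementGenerator_of_isometry {dS dE n : ℕ} {φ : Fin dE → ℂ}
    {ω : Fin dS × Fin dE → ℂ} {J : Matrix (Fin dS × Fin dE) (Fin n) ℂ}
    (hJ : J.conjTranspose * J = 1) (hφ : ∀ x : Fin dS → ℂ, J.conjTranspose.mulVec (prodVec x φ) = 0)
    (hω : J.conjTranspose.mulVec ω = 0) (Y : suLie n) :
    IsComplementGenerator φ ω (J * (Y : Matrix (Fin n) (Fin n) ℂ) * J.conjTranspose) where
  conjTranspose_eq := by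
    rw [Matrix.conjTranspose_mul, Matrix.conjTranspose_mul, Matrix.conjTranspose_conjTranspose,
      Y.2.1, Matrix.neg_mul, Matrix.mul_neg, Matrix.mul_assoc]
  trace_eq := by
    rw [Matrix.mul_assoc, Matrix.trace_mul_comm, Matrix.mul_assoc, hJ, Matrix.mul_one, Y.2.2]
  mulVec_prodVec x := by rw [← Matrix.mulVec_mulVec, hφ, Matrix.mulVec_zero]
  mulVec_target := by rw [← Matrix.mulVec_mulVec, hω, Matrix.mulVec_zero]

/-- The part of the generator on the complement can be recovered from the evolution by a linear
compression. -/
theorem conjTranspose_mul_evolution_mul {dS dE n : ℕ} {a : Fin dS → ℂ} {φ : Fin dE → ℂ}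
    {ω : Fin dS × Fin dE → ℂ} {J : Matrix (Fin dS × Fin dE) (Fin n) ℂ}
    (hJ : J.conjTranspose * J = 1) (hφ : ∀ x : Fin dS → ℂ, J.conjTranspose.mulVec (prodVec x φ) = 0)
    (hω : J.conjTranspose.mulVec ω = 0) (Y : Matrix (Fin n) (Fin n) ℂ) (t : ℝ) :
    J.conjTranspose
        * evolution (Complex.I • dampingGenerator a φ ω (J * Y * J.conjTranspose)) t * J
      = NormedSpace.exp ((t : ℂ) • Y) := by
  have h0 : ∀ v : Fin dS × Fin dE → ℂ, J.conjTranspose.mulVec v = 0 →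
      Matrix.vecMul (star v) J = 0 := by
    intro v hv
    rw [← Matrix.conjTranspose_conjTranspose J, ← Matrix.star_mulVec, hv, star_zero]
  have hG : ((t : ℂ) • dampingGenerator a φ ω (J * Y * J.conjTranspose)) * J
      = J * ((t : ℂ) • Y) := by
    rw [dampingGenerator, Matrix.smul_mul, Matrix.add_mul, Matrix.sub_mul, Matrix.vecMulVec_mul,
      Matrix.vecMulVec_mul, h0 _ (hφ a), h0 _ hω, Matrix.mul_assoc, hJ, Matrix.mul_one,
      Matrix.mul_smul]
    ext p l
    simp [Matrix.vecMulVec_apply]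
  rw [evolution_I_smul, Matrix.mul_assoc, exp_mul_eq_mul_exp hG, ← Matrix.mul_assoc, hJ,
    Matrix.one_mul]

section Dimension

attribute [local instance] Matrix.linftyOpNormedRing Matrix.linftyOpNormedAlgebra

/-- The derivative at `0` of `Y ↦ π (exp (t Y))` is multiplication by `t`, so the map is open
there. -/
theorem range_proj_exp_mem_nhds {n : ℕ} (π : Matrix (Fin n) (Fin n) ℂ →ₗ[ℝ] suLie n)
    (hπ : ∀ Y : suLie n, π Y = Y) {t : ℝ} (ht : t ≠ 0) :
    Set.range (fun Y : suLie n => π (NormedSpace.exp ((t : ℂ) • (Y : Matrix (Fin n) (Fin n) ℂ))))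
      ∈ nhds (π (NormedSpace.exp (0 : Matrix (Fin n) (Fin n) ℂ))) := by
  let πc : Matrix (Fin n) (Fin n) ℂ →L[ℝ] suLie n := LinearMap.toContinuousLinearMap π
  let ι : suLie n →L[ℝ] Matrix (Fin n) (Fin n) ℂ := t • (suLie n).subtypeL
  have hι : ∀ Y : suLie n, ι Y = (t : ℂ) • (Y : Matrix (Fin n) (Fin n) ℂ) := by
    intro Y
    ext i j
    simp [ι]
  have hexp : HasStrictFDerivAt (NormedSpace.exp : Matrix (Fin n) (Fin n) ℂ → _)
      (1 : Matrix (Fin n) (Fin n) ℂ →L[ℝ] Matrix (Fin n) (Fin n) ℂ) (ι 0) := by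
    rw [map_zero]
    exact hasStrictFDerivAt_exp_zero
  have hF : HasStrictFDerivAt (fun Y : suLie n => πc (NormedSpace.exp (ι Y)))
      (πc.comp ((1 : Matrix (Fin n) (Fin n) ℂ →L[ℝ] Matrix (Fin n) (Fin n) ℂ).comp ι)) 0 :=
    πc.hasStrictFDerivAt.comp (0 : suLie n) (hexp.comp (0 : suLie n) ι.hasStrictFDerivAt)
  have hsurj : (πc.comp
      ((1 : Matrix (Fin n) (Fin n) ℂ →L[ℝ] Matrix (Fin n) (Fin n) ℂ).comp ι)).range = ⊤ := by
    refine LinearMap.range_eq_top.2 fun Y => ⟨t⁻¹ • Y, ?_⟩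
    change π (t • ((t⁻¹ • Y : suLie n) : Matrix (Fin n) (Fin n) ℂ)) = Y
    rw [map_smul, hπ, smul_inv_smul₀ ht]
  have hmap := hF.map_nhds_eq_of_surj hsurj
  rw [map_zero] at hmap
  change _ ∈ nhds (πc (NormedSpace.exp 0))
  refine hmap.ge (Filter.mem_map.2 (Filter.univ_mem' fun Y => ⟨Y, ?_⟩))
  exact congrArg (fun X => π (NormedSpace.exp X)) (hι Y).symm

/-- A set of matrices that has every `exp (t Y)`, `Y ∈ su(n)`, among its compressions by `J` has
Hausdorff dimension at least `dim SU(n)`: linear maps are Lipschitz and do not raise the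
dimension. -/
theorem dimSU_le_matrixDimH {ι : Type} [Fintype ι] {n : ℕ} {A : Set (Matrix ι ι ℂ)}
    (J : Matrix ι (Fin n) ℂ) {t : ℝ} (ht : t ≠ 0)
    (hA : ∀ Y : suLie n, ∃ U ∈ A, J.conjTranspose * U * J
      = NormedSpace.exp ((t : ℂ) • (Y : Matrix (Fin n) (Fin n) ℂ))) :
    (dimSU n : ℝ≥0∞) ≤ matrixDimH A := by
  obtain ⟨π, hπ⟩ := LinearMap.exists_leftInverse_of_injective (suLie n).subtype
    (Submodule.ker_subtype _)
  have hπ' : ∀ Y : suLie n, π Y = Y := fun Y => LinearMap.congr_fun hπ Y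
  let g : EuclideanSpace ℂ (ι × ι) →ₗ[ℝ] suLie n :=
    { toFun := fun x => π (J.conjTranspose * (Matrix.of fun i j => x (i, j)) * J)
      map_add' := by
        intro x y
        rw [← map_add, ← Matrix.add_mul, ← Matrix.mul_add]
        rfl
      map_smul' := by
        intro c x
        rw [RingHom.id_apply, ← map_smul, ← Matrix.smul_mul, ← Matrix.mul_smul]
        rfl }
  have hlip := (LinearMap.toContinuousLinearMap g).lipschitz
  have himage : Set.range
      (fun Y : suLie n => π (NormedSpace.exp ((t : ℂ) • (Y : Matrix (Fin n) (Fin n) ℂ))))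
      ⊆ LinearMap.toContinuousLinearMap g ''
        {x : EuclideanSpace ℂ (ι × ι) | (Matrix.of fun i j => x (i, j)) ∈ A} := by
    rintro _ ⟨Y, rfl⟩
    obtain ⟨U, hU, hJU⟩ := hA Y
    refine ⟨WithLp.toLp 2 fun p => U p.1 p.2, hU, ?_⟩
    change π (J.conjTranspose * U * J) = _
    rw [hJU]
  calc (dimSU n : ℝ≥0∞)
      = dimH (Set.range
        fun Y : suLie n => π (NormedSpace.exp ((t : ℂ) • (Y : Matrix (Fin n) (Fin n) ℂ)))) :=
        (Real.dimH_of_mem_nhds (range_proj_exp_mem_nhds π hπ' ht)).symm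
    _ ≤ _ := dimH_mono himage
    _ ≤ matrixDimH A := hlip.dimH_image_le _

end Dimension

theorem cpUnitaries_infinite {dS dE : ℕ} (hS : 2 ≤ dS) (hE : 2 ≤ dE)
    {Φ : Fin dS × Fin dE → ℂ} (hΦ : IsState Φ) : (cpUnitaries Φ).Infinite := by
  obtain ⟨a, φ, ω, s, h, hs0, hs1, rfl⟩ := exists_isDampingFrame hS hE hΦ
  have hZ : IsComplementGenerator φ ω (0 : Matrix (Fin dS × Fin dE) (Fin dS × Fin dE) ℂ) :=
    ⟨by simp, by simp, by simp, by simp⟩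
  refine Set.infinite_of_injOn_mapsTo
    (f := fun t => evolution (Complex.I • dampingGenerator a φ ω 0) t)
    (s := Set.Ioo 0 (Real.pi / 2 - s)) ?_ ?_ (Set.Ioo_infinite (by linarith))
  · intro t ht t' ht' heq
    have hcos : ∀ r : ℝ, star (prodVec a φ) ⬝ᵥ
        (evolution (Complex.I • dampingGenerator a φ ω 0) r).mulVec (prodVec a φ)
          = (Real.cos r : ℂ) := by
      intro r
      rw [h.evolution_mulVec_prodVec_self hZ, dotProduct_add, dotProduct_smul, dotProduct_smul,
        h.isState_prodVec, h.prodVec_orthogonal]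
      simp
    have h1 : (Real.cos t : ℂ) = Real.cos t' := by
      rw [← hcos, ← hcos]
      exact congrArg (fun U => star (prodVec a φ) ⬝ᵥ Matrix.mulVec U (prodVec a φ)) heq
    have hpi := Real.pi_pos
    exact Real.injOn_cos ⟨ht.1.le, by linarith [ht.2]⟩ ⟨ht'.1.le, by linarith [ht'.2]⟩
      (by exact_mod_cast h1)
  · intro t ht
    exact h.evolution_mem_cpUnitaries hZ hs0 ht.1 (by linarith [ht.2])

theorem dimSU_le_matrixDimH_cpUnitaries {dS dE : ℕ} (hS : 2 ≤ dS) (hE : 2 ≤ dE)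
    {Φ : Fin dS × Fin dE → ℂ} (hΦ : IsState Φ) :
    (dimSU (dS * dE - (dS + 1)) : ℝ≥0∞) ≤ matrixDimH (cpUnitaries Φ) := by
  obtain ⟨a, φ, ω, s, h, hs0, hs1, rfl⟩ := exists_isDampingFrame hS hE hΦ
  obtain ⟨J, hJ, hφ, hω⟩ := exists_isometry_orthogonal φ ω
  have ht : 0 < (Real.pi / 2 - s) / 2 := by linarith
  refine dimSU_le_matrixDimH J ht.ne' fun Y => ⟨_, h.evolution_mem_cpUnitaries
    (isComplementGenerator_of_isometry hJ hφ hω Y) hs0 ht (by linarith), ?_⟩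
  exact conjTranspose_mul_evolution_mul hJ hφ hω _ _

theorem ofReal_paramRatio_le_relDim {dS dE : ℕ} (hS : 2 ≤ dS) (hE : 4 ≤ dE)
    {Φ : Fin dS × Fin dE → ℂ} (hΦ : IsState Φ) :
    ENNReal.ofReal (paramRatio dS dE) ≤ relDim (cpUnitaries Φ) := by
  have hpos : 0 < dimSU (dS * dE) := by
    have h8 : 2 * 4 ≤ dS * dE := Nat.mul_le_mul hS hE
    rw [dimSU_eq (by omega)]
    have : 2 ^ 2 ≤ (dS * dE) ^ 2 := Nat.pow_le_pow_left (by omega) 2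
    omega
  have hcast : ENNReal.ofReal (paramRatio dS dE)
      = ((dimSU dS + dimSU dE : ℕ) : ℝ≥0∞) / (dimSU (dS * dE) : ℝ≥0∞) := by
    rw [paramRatio, ENNReal.ofReal_div_of_pos (by exact_mod_cast hpos), ← Nat.cast_add,
      ENNReal.ofReal_natCast, ENNReal.ofReal_natCast]
  rw [hcast, relDim]
  refine ENNReal.div_le_div_right (le_trans ?_
    (dimSU_le_matrixDimH_cpUnitaries hS (by omega) hΦ)) _
  exact_mod_cast dimSU_add_dimSU_le hS hE

theorem theorem1 :
    (∀ (dS dE : ℕ), 2 ≤ dS → 2 ≤ dE →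
      ∀ Φ : Fin dS × Fin dE → ℂ, IsState Φ → ¬ IsMaxEntangled Φ →
        (cpUnitaries Φ).Infinite ∧
        (4 ≤ dE → ENNReal.ofReal (paramRatio dS dE) ≤ relDim (cpUnitaries Φ))) ∧
    (∀ ε : ℝ, 0 < ε → ∃ M : ℕ, ∀ dS dE : ℕ, 2 ≤ dS → 2 ≤ dE → M ≤ dS + dE →
      |paramRatio dS dE / (((dS : ℝ) ^ 2 + (dE : ℝ) ^ 2) / ((dS : ℝ) ^ 2 * (dE : ℝ) ^ 2)) - 1|
        < ε) ∧
    (∀ dS : ℕ, 2 ≤ dS →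
      Filter.Tendsto (fun dE : ℕ => paramRatio dS dE) Filter.atTop (nhds (((dS : ℝ) ^ 2)⁻¹))) := by
  refine ⟨fun dS dE hS hE Φ hΦ _ => ⟨cpUnitaries_infinite hS hE hΦ,
    fun hE4 => ofReal_paramRatio_le_relDim hS hE4 hΦ⟩, fun ε hε => ?_,
    fun dS hS => tendsto_paramRatio hS⟩
  obtain ⟨M, hM⟩ := exists_nat_gt (4 / ε)
  refine ⟨M, fun dS dE hS hE hMd => (abs_paramRatio_div_sub_one_le hS hE).trans_lt ?_⟩
  have h1 : (M : ℝ) ≤ (dS : ℝ) + dE := by exact_mod_cast hMd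
  have h2 : 0 < 4 / ε := by positivity
  rw [div_lt_comm₀ (by linarith) hε]
  linarith
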